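/- For every integer $\ell\ge 1$ there are constants $c_1(\ell),c_2(\ell)>0$, depending only on $\ell$, such that the following holds. Let $n\ge 1$ be an integer, let $\delta\in(0,\tfrac1\ell)$ and $\rho>0$, and let $W\subseteq(\mathbb{R}^n)^{\otimes\ell}=\mathbb{R}^{n\times\cdots\times n}$ be any linear subspace of dimension at least $\delta n^\ell$. Let $x_1,\dots,x_\ell\in\mathbb{R}^n$ be arbitrary, and let $\tilde x_j=x_j+z_j$ for $1\le j\le\ell$ be their $\rho$-perturbations: $z_1,\dots,z_\ell$ are independent random vectors in $\mathbb{R}^n$, the $n$ coordinates of each being independent Gaussians with mean $0$ and variance $\rho^2/n$. Then $$\Pr\Big[\big\|\Pi_W(\tilde x_1\otimes\tilde x_2\otimes\cdots\otimes\tilde x_\ell)\big\|_2<\frac{c_1(\ell)\,\rho^\ell}{n^\ell}\Big]\le\exp\big(-c_2(\ell)\,\delta n\big),$$ where $\Pi_W$ is the orthogonal projection onto $W$ and $\|\cdot\|_2$ is the Euclidean (Frobenius) norm of a tensor. -/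

import Mathlib

open MeasureTheory ProbabilityTheory

/-- The space `ℝ^{n × ⋯ × n}` of real tensors of order `ℓ`, as arrays of `n ^ ℓ` real entries
indexed by `(i₁, …, i_ℓ)`, with the Euclidean (Frobenius) inner product and norm. -/
abbrev TensorSpace (n ℓ : ℕ) : Type := EuclideanSpace ℝ (Fin ℓ → Fin n)

/-- The rank-one tensor `v₁ ⊗ ⋯ ⊗ v_ℓ`, with entries `v₁(i₁) ⋯ v_ℓ(i_ℓ)`. -/
noncomputable def rankOneTensor {n ℓ : ℕ} (v : Fin ℓ → EuclideanSpace ℝ (Fin n)) :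
    TensorSpace n ℓ :=
  WithLp.toLp 2 fun i => ∏ j, v j (i j)

/-- `z₁, …, z_ℓ` are independent random vectors in `ℝ^n`, each distributed as `N(0, ρ²/n)^n`:
all the `ℓ * n` coordinates are mutually independent centred Gaussians of variance `ρ² / n`. -/
structure IsPerturbationNoise {Ω : Type*} [MeasurableSpace Ω] (P : Measure Ω) {n ℓ : ℕ} (ρ : ℝ)
    (z : Fin ℓ → Ω → EuclideanSpace ℝ (Fin n)) : Prop where
  hasLaw : ∀ j i, HasLaw (fun ω => z j ω i) (gaussianReal 0 (ρ ^ 2 / n).toNNReal) P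
  indep : iIndepFun (fun (p : Fin ℓ × Fin n) ω => z p.1 ω p.2) P

/-! It suffices to find finitely many `w ∈ W` with entries at most `1` such that, outside an event
of probability `exp (-m)`, `m = ⌈δn/ℓ⌉`, some `⟨w, x̃₁ ⊗ ⋯ ⊗ x̃_ℓ⟩` is at least `η ^ ℓ`, where `η =
bρ/√n`; since `‖w‖ ≤ √n ^ ℓ`, the projection is then at least `(bρ/n) ^ ℓ`.

The vectors are contracted one mode at a time. If the coefficient of one Gaussian coordinate is at
least `η ^ k`, the next contraction drops below `η ^ (k + 1)` with probability at most `b`. To get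
`b ^ m`, one uses `m` families in echelon form: each vanishes on the slices of the earlier ones, so
the coordinate that decides a family does not affect the later families and the failures multiply
(`measure_iInter_smallContractionSet_succ_le`). Such families are built greedily: while no `m`
slices lie on a common line, the slices used so far cover few positions, and a large subspace of `V`
still vanishes on them (`exists_measure_smallContractionSet_le`). -/

open scoped ENNReal

/-! ### Small-ball estimates in a single coordinate -/

/-- If every fibre of `E` in the direction of coordinate `i` has measure at most `b` and `G` does
not depend on coordinate `i`, then `μ (E ∩ G) ≤ b μ G` for the product measure `μ`. -/
lemma measure_pi_inter_le_of_fibre_le {ι : Type*} [Fintype ι] [DecidableEq ι] {X : ι → Type*}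
    [∀ i, MeasurableSpace (X i)] (μ : ∀ i, Measure (X i)) [∀ i, IsProbabilityMeasure (μ i)] (i : ι)
    {E G : Set (∀ i, X i)} (hE : MeasurableSet E) (hG : MeasurableSet G) (b : ℝ≥0∞)
    (hEb : ∀ y, μ i {a | Function.update y i a ∈ E} ≤ b)
    (hGi : ∀ y a, Function.update y i a ∈ G ↔ y ∈ G) :
    Measure.pi μ (E ∩ G) ≤ b * Measure.pi μ G := by
  have hEG := hE.inter hG
  rw [← lintegral_indicator_one hEG, ← lintegral_indicator_one hG,
    ← lintegral_const_mul b (measurable_one.indicator hG)]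
  rcases isEmpty_or_nonempty (∀ i, X i) with h | ⟨⟨y₀⟩⟩
  · simp
  have hf : Measurable (Set.indicator (E ∩ G) (1 : (∀ i, X i) → ℝ≥0∞)) :=
    measurable_one.indicator hEG
  have hg : Measurable (Set.indicator G (1 : (∀ i, X i) → ℝ≥0∞)) := measurable_one.indicator hG
  -- Tonelli, with coordinate `i` integrated innermost, reduces the claim to single fibres.
  rw [lintegral_eq_lmarginal_univ y₀, lintegral_eq_lmarginal_univ y₀,
    lmarginal_erase' _ hf (Finset.mem_univ i),
    lmarginal_erase' _ (hg.const_mul b) (Finset.mem_univ i)]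
  refine lmarginal_mono (fun y => ?_) y₀
  have hmE : MeasurableSet {a | Function.update y i a ∈ E} := measurable_update y hE
  by_cases hy : y ∈ G
  · calc ∫⁻ a, (E ∩ G).indicator 1 (Function.update y i a) ∂μ i
        = ∫⁻ a, Set.indicator {a | Function.update y i a ∈ E} 1 a ∂μ i := by
          refine lintegral_congr fun a => ?_
          by_cases h : Function.update y i a ∈ E <;> simp [h, (hGi y a).2 hy]
      _ ≤ b := by rw [lintegral_indicator_one hmE]; exact hEb y
      _ = ∫⁻ a, b * G.indicator 1 (Function.update y i a) ∂μ i := by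
          simp [(hGi y _).2 hy]
  · calc ∫⁻ a, (E ∩ G).indicator 1 (Function.update y i a) ∂μ i
        = ∫⁻ _, 0 ∂μ i := by
          refine lintegral_congr fun a => ?_
          simp [mt (hGi y a).1 hy]
      _ ≤ _ := by simp

/-- An interval of radius `r` has `N(m, v)`-measure at most `r / √v`. -/
lemma gaussianReal_abs_add_lt_le (m : ℝ) {v : NNReal} (hv : v ≠ 0) (c r : ℝ) :
    gaussianReal m v {t | |t + c| < r} ≤ ENNReal.ofReal (r / √v) := by
  have hv' : (0 : ℝ) < v := by positivity
  have hs : 0 < √(v : ℝ) := Real.sqrt_pos.2 hv'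
  have hset : {t : ℝ | |t + c| < r} = Metric.ball (-c) r := by
    ext t; simp [Real.dist_eq]
  rw [gaussianReal_apply m hv]
  -- The interval has length `2r`, so the crude density bound coming from `4 ≤ 2π` is enough.
  have hpdf : ∀ t, gaussianPDF m v t ≤ ENNReal.ofReal (1 / (2 * √v)) := by
    intro t
    refine ENNReal.ofReal_le_ofReal ?_
    rw [gaussianPDFReal_def]
    have h1 : Real.exp (-(t - m) ^ 2 / (2 * v)) ≤ 1 := by
      rw [Real.exp_le_one_iff]
      exact div_nonpos_of_nonpos_of_nonneg (by nlinarith [sq_nonneg (t - m)]) (by positivity)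
    have h2 : 2 * √(v : ℝ) ≤ √(2 * Real.pi * v) := by
      apply Real.le_sqrt_of_sq_le
      rw [mul_pow, Real.sq_sqrt hv'.le]
      nlinarith [Real.pi_gt_three]
    calc (√(2 * Real.pi * v))⁻¹ * Real.exp (-(t - m) ^ 2 / (2 * v))
        ≤ (√(2 * Real.pi * v))⁻¹ * 1 := by gcongr
      _ ≤ 1 / (2 * √v) := by
        rw [mul_one, one_div]
        gcongr
  calc ∫⁻ t in {t | |t + c| < r}, gaussianPDF m v t
      ≤ ∫⁻ _ in {t | |t + c| < r}, ENNReal.ofReal (1 / (2 * √v)) :=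
        lintegral_mono fun t => hpdf t
    _ = ENNReal.ofReal (r / √v) := by
        rw [setLIntegral_const, hset, Real.volume_ball, ← ENNReal.ofReal_mul (by positivity)]
        congr 1
        field_simp

/-! ### Contracting the first modes of a tensor -/

section PartialContraction

variable {n ℓ : ℕ}

/-- Contraction of the modes `j < k` of `w` with the vectors `y (j, ·)`, the remaining indices
being those of `p`. -/
noncomputable def partialContraction (k : ℕ) (w : TensorSpace n ℓ) (p : Fin ℓ → Fin n)
    (y : Fin ℓ × Fin n → ℝ) : ℝ :=
  ∑ t : Fin ℓ → Fin n with ∀ j : Fin ℓ, k ≤ j → t j = p j,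
    w t * ∏ j ∈ Finset.univ.filter fun j : Fin ℓ => (j : ℕ) < k, y (j, t j)

lemma partialContraction_zero (w : TensorSpace n ℓ) (p : Fin ℓ → Fin n)
    (y : Fin ℓ × Fin n → ℝ) : partialContraction 0 w p y = w p := by
  have : (Finset.univ.filter fun t : Fin ℓ → Fin n => ∀ j : Fin ℓ, 0 ≤ (j : ℕ) → t j = p j)
      = {p} := by
    ext t; simp [funext_iff]
  rw [partialContraction, this]
  simp

lemma partialContraction_self (w : TensorSpace n ℓ) (p : Fin ℓ → Fin n)
    (y : Fin ℓ × Fin n → ℝ) :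
    partialContraction ℓ w p y = ∑ t, w t * ∏ j, y (j, t j) := by
  have h : ∀ t : Fin ℓ → Fin n, ∀ j : Fin ℓ, ℓ ≤ (j : ℕ) → t j = p j :=
    fun t j hj => absurd j.2 (by omega)
  rw [partialContraction, Finset.filter_true_of_mem (fun t _ => h t)]
  simp

/-- Grouping the terms by their index in mode `k` exhibits the next contraction as a linear form in
the `k`-th vector, whose coefficients involve only the earlier vectors. -/
lemma partialContraction_succ {k : ℕ} (hk : k < ℓ) (w : TensorSpace n ℓ) (p : Fin ℓ → Fin n)
    (y : Fin ℓ × Fin n → ℝ) :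
    partialContraction (k + 1) w p y
      = ∑ i, y (⟨k, hk⟩, i) * partialContraction k w (Function.update p ⟨k, hk⟩ i) y := by
  unfold partialContraction
  rw [← Finset.sum_fiberwise _ (fun t : Fin ℓ → Fin n => t ⟨k, hk⟩)]
  refine Finset.sum_congr rfl fun i _ => ?_
  rw [Finset.mul_sum, Finset.filter_filter]
  refine Finset.sum_congr ?_ fun t ht => ?_
  · ext t
    simp only [Finset.mem_filter, Finset.mem_univ, true_and]
    constructor
    · rintro ⟨h1, h2⟩ j hj
      rcases eq_or_ne j ⟨k, hk⟩ with rfl | hne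
      · simpa using h2
      · have : (j : ℕ) ≠ k := fun h => hne (Fin.ext h)
        rw [Function.update_of_ne hne]
        exact h1 j (by omega)
    · intro h
      refine ⟨fun j hj => ?_, by simpa using h ⟨k, hk⟩ le_rfl⟩
      have hne : j ≠ ⟨k, hk⟩ := by rintro rfl; simp at hj
      simpa [Function.update_of_ne hne] using h j (by omega)
  · have hti : t ⟨k, hk⟩ = i := by
      have := (Finset.mem_filter.1 ht).2 ⟨k, hk⟩ le_rfl
      simpa using this
    have hins : (Finset.univ.filter fun j : Fin ℓ => (j : ℕ) < k + 1)
        = insert ⟨k, hk⟩ (Finset.univ.filter fun j : Fin ℓ => (j : ℕ) < k) := by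
      ext j
      simp only [Finset.mem_filter, Finset.mem_univ, true_and, Finset.mem_insert, Fin.ext_iff]
      omega
    rw [hins, Finset.prod_insert (by simp), hti]
    ring

lemma partialContraction_update {k : ℕ} (w : TensorSpace n ℓ) (p : Fin ℓ → Fin n)
    (y : Fin ℓ × Fin n → ℝ) {j : Fin ℓ} (hj : k ≤ j) (i : Fin n) (a : ℝ) :
    partialContraction k w p (Function.update y (j, i) a) = partialContraction k w p y := by
  unfold partialContraction
  refine Finset.sum_congr rfl fun t _ => ?_
  congr 1
  refine Finset.prod_congr rfl fun j' hj' => ?_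
  have : j' ≠ j := by
    rintro rfl
    have := (Finset.mem_filter.1 hj').2
    omega
  rw [Function.update_of_ne (by simp [this])]

lemma partialContraction_congr {k : ℕ} (w : TensorSpace n ℓ) {p p' : Fin ℓ → Fin n}
    (h : ∀ j : Fin ℓ, k ≤ j → p j = p' j) :
    partialContraction k w p = partialContraction k w p' := by
  funext y
  unfold partialContraction
  refine Finset.sum_congr ?_ fun _ _ => rfl
  ext t
  simp only [Finset.mem_filter, Finset.mem_univ, true_and]
  exact forall₂_congr fun j hj => by rw [h j hj]

lemma partialContraction_eq_zero {k : ℕ} {w : TensorSpace n ℓ} {p : Fin ℓ → Fin n}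
    (h : ∀ t : Fin ℓ → Fin n, (∀ j : Fin ℓ, k ≤ j → t j = p j) → w t = 0)
    (y : Fin ℓ × Fin n → ℝ) : partialContraction k w p y = 0 :=
  Finset.sum_eq_zero fun t ht => by rw [h t (Finset.mem_filter.1 ht).2, zero_mul]

@[fun_prop]
lemma continuous_partialContraction (k : ℕ) (w : TensorSpace n ℓ) (p : Fin ℓ → Fin n) :
    Continuous (partialContraction k w p) := by
  unfold partialContraction
  fun_prop

/-- The contraction of `k + 1` modes is affine in each coordinate of the `k`-th vector. -/
lemma partialContraction_succ_update {k : ℕ} (hk : k < ℓ) (w : TensorSpace n ℓ)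
    (p : Fin ℓ → Fin n) (y : Fin ℓ × Fin n → ℝ) (i : Fin n) (a : ℝ) :
    partialContraction (k + 1) w p (Function.update y (⟨k, hk⟩, i) a)
      = a * partialContraction k w (Function.update p ⟨k, hk⟩ i) y
        + ∑ i' ∈ Finset.univ.erase i,
          y (⟨k, hk⟩, i') * partialContraction k w (Function.update p ⟨k, hk⟩ i') y := by
  rw [partialContraction_succ hk, ← Finset.add_sum_erase _ _ (Finset.mem_univ i)]
  congr 1
  · rw [partialContraction_update (j := ⟨k, hk⟩) _ _ _ le_rfl]; simp
  · refine Finset.sum_congr rfl fun i' hi' => ?_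
    rw [partialContraction_update (j := ⟨k, hk⟩) _ _ _ le_rfl,
      Function.update_of_ne (by simpa using Finset.ne_of_mem_erase hi')]

end PartialContraction

/-! ### Combining families in echelon form -/

section SmallContraction

variable {n ℓ : ℕ}

/-- The vectors `y` for which contracting the first `k` modes of any tensor in `F` gives an entry
at `p` of size less than `η ^ k`. -/
def smallContractionSet (η : ℝ) (k : ℕ) (F : Finset (TensorSpace n ℓ)) (p : Fin ℓ → Fin n) :
    Set (Fin ℓ × Fin n → ℝ) :=
  {y | ∀ w ∈ F, |partialContraction k w p y| < η ^ k}

lemma measurableSet_smallContractionSet (η : ℝ) (k : ℕ) (F : Finset (TensorSpace n ℓ))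
    (p : Fin ℓ → Fin n) : MeasurableSet (smallContractionSet η k F p) := by
  have : smallContractionSet η k F p
      = ⋂ w ∈ F, {y | |partialContraction k w p y| < η ^ k} := by
    ext y; simp [smallContractionSet]
  rw [this]
  exact F.measurableSet_biInter fun w _ =>
    (isOpen_lt (by fun_prop) continuous_const).measurableSet

/-- A finite chain of index prefixes `p i` sharing the entries after `k`, with families `F i`
vanishing on the slices of the earlier prefixes: if every `F i` has a large contraction at `p i`
outside an event of probability `q`, then some `F i` has a large contraction of one more mode
outside an event of probability `b ^ #I + 2 q`. -/
lemma measure_iInter_smallContractionSet_succ_le (μ : Fin ℓ × Fin n → Measure ℝ)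
    [∀ i, IsProbabilityMeasure (μ i)] {η : ℝ} (hη : 0 < η) {b q : ℝ≥0∞} (hb : 2 * b ≤ 1)
    (hμ : ∀ i c, μ i {t | |t + c| < η} ≤ b) {k : ℕ} (hk : k < ℓ) (t : Fin ℓ → Fin n)
    (p : ℕ → Fin ℓ → Fin n) (F : ℕ → Finset (TensorSpace n ℓ)) (I : Finset ℕ)
    (hp : ∀ i ∈ I, ∀ j : Fin ℓ, k < j → p i j = t j)
    (hF : ∀ i ∈ I, ∀ i' ∈ I, i' < i → ∀ w ∈ F i, ∀ s : Fin ℓ → Fin n,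
      (∀ j : Fin ℓ, k ≤ j → s j = p i' j) → w s = 0)
    (hq : ∀ i ∈ I, Measure.pi μ (smallContractionSet η k (F i) (p i)) ≤ q) :
    Measure.pi μ (⋂ i ∈ I, smallContractionSet η (k + 1) (F i) t) ≤ b ^ I.card + 2 * q := by
  classical
  -- The smallest index is split off because all the other families vanish on its slice.
  induction I using Finset.induction_on_min with
  | empty => simp
  | insert i₀ I hmin ih =>
    have hi₀ : i₀ ∉ I := fun h => lt_irrefl _ (hmin i₀ h)
    specialize ih (fun i hi => hp i (Finset.mem_insert_of_mem hi))
      (fun i hi i' hi' => hF i (Finset.mem_insert_of_mem hi) i' (Finset.mem_insert_of_mem hi'))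
      (fun i hi => hq i (Finset.mem_insert_of_mem hi))
    set R := ⋂ i ∈ I, smallContractionSet η (k + 1) (F i) t with hR
    set S := smallContractionSet η k (F i₀) (p i₀) with hS
    set E := smallContractionSet η (k + 1) (F i₀) t \ S with hE
    have hRm : MeasurableSet R :=
      I.measurableSet_biInter fun i _ => measurableSet_smallContractionSet _ _ _ _
    have hEm : MeasurableSet E := (measurableSet_smallContractionSet _ _ _ _).diff
      (measurableSet_smallContractionSet _ _ _ _)
    have hslice : ∀ j : Fin ℓ, k ≤ j →
        Function.update t ⟨k, hk⟩ (p i₀ ⟨k, hk⟩) j = p i₀ j := by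
      intro j hj
      rcases eq_or_ne j ⟨k, hk⟩ with rfl | hne
      · simp
      · have : (j : ℕ) ≠ k := fun h => hne (Fin.ext h)
        rw [Function.update_of_ne hne, hp i₀ (Finset.mem_insert_self _ _) j (by omega)]
    have hmain : Measure.pi μ (E ∩ R) ≤ b * Measure.pi μ R := by
      refine measure_pi_inter_le_of_fibre_le μ (⟨k, hk⟩, p i₀ ⟨k, hk⟩) hEm hRm b ?_ ?_
      · intro y
        -- `S` does not involve the `k`-th vector, so membership is constant along the fibre.
        -- Outside `S`, the varying coordinate has a coefficient `A` with `|A| ≥ η ^ k`.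
        by_cases hy : y ∈ S
        · have : {a | Function.update y (⟨k, hk⟩, p i₀ ⟨k, hk⟩) a ∈ E} = ∅ := by
            refine Set.eq_empty_of_forall_notMem fun a ha => ha.2 fun w hw => ?_
            rw [partialContraction_update (j := ⟨k, hk⟩) _ _ _ le_rfl]
            exact hy w hw
          simp [this]
        · obtain ⟨w, hw, hwy⟩ : ∃ w ∈ F i₀, η ^ k ≤ |partialContraction k w (p i₀) y| := by
            simpa [hS, smallContractionSet] using hy
          set A := partialContraction k w (p i₀) y with hA
          have hA0 : 0 < |A| := lt_of_lt_of_le (pow_pos hη k) hwy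
          have hA0' : A ≠ 0 := abs_pos.1 hA0
          refine le_trans (measure_mono fun a ha => ?_)
            (hμ (⟨k, hk⟩, p i₀ ⟨k, hk⟩) ((∑ i' ∈ Finset.univ.erase (p i₀ ⟨k, hk⟩),
              y (⟨k, hk⟩, i') * partialContraction k w (Function.update t ⟨k, hk⟩ i') y) / A))
          have h := ha.1 w hw
          rw [partialContraction_succ_update, partialContraction_congr w hslice, ← hA] at h
          set c := ∑ i' ∈ Finset.univ.erase (p i₀ ⟨k, hk⟩),
            y (⟨k, hk⟩, i') * partialContraction k w (Function.update t ⟨k, hk⟩ i') y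
          have h2 : a * A + c = A * (a + c / A) := by field_simp
          rw [h2, abs_mul] at h
          by_contra hcon
          have hcon' : η ≤ |a + c / A| := not_lt.1 hcon
          have := mul_le_mul hwy hcon' hη.le hA0.le
          rw [← pow_succ] at this
          linarith
      · intro y a
        -- The coefficient of this coordinate is a contraction over the slice of `p i₀`, where the
        -- later families vanish.
        have hC : ∀ i ∈ I, ∀ w ∈ F i, partialContraction (k + 1) w t
            (Function.update y (⟨k, hk⟩, p i₀ ⟨k, hk⟩) a) = partialContraction (k + 1) w t y := by
          intro i hi w hw
          have h0 : ∀ y, partialContraction k w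
              (Function.update t ⟨k, hk⟩ (p i₀ ⟨k, hk⟩)) y = 0 := by
            intro y
            rw [partialContraction_congr w hslice]
            exact partialContraction_eq_zero (hF i (Finset.mem_insert_of_mem hi) i₀
              (Finset.mem_insert_self _ _) (hmin i hi) w hw) y
          rw [partialContraction_succ_update, partialContraction_succ hk,
            ← Finset.add_sum_erase _ _ (Finset.mem_univ (p i₀ ⟨k, hk⟩)), h0, mul_zero, mul_zero]
        simp only [hR, Set.mem_iInter, smallContractionSet, Set.mem_ofPred_eq]
        exact forall₄_congr fun i hi w hw => by rw [hC i hi w hw]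
    have hsub : (⋂ i ∈ insert i₀ I, smallContractionSet η (k + 1) (F i) t) ⊆ S ∪ (E ∩ R) := by
      intro y hy
      rw [Finset.set_biInter_insert] at hy
      by_cases h : y ∈ S
      · exact Or.inl h
      · exact Or.inr ⟨⟨hy.1, h⟩, hy.2⟩
    calc Measure.pi μ (⋂ i ∈ insert i₀ I, smallContractionSet η (k + 1) (F i) t)
        ≤ Measure.pi μ S + Measure.pi μ (E ∩ R) :=
          (measure_mono hsub).trans (measure_union_le _ _)
      _ ≤ q + b * (b ^ I.card + 2 * q) := by
          gcongr
          · exact hq i₀ (Finset.mem_insert_self _ _)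
          · exact hmain.trans (by gcongr)
      -- The inherited error `2q` is halved by `b ≤ 1/2`, so the total stays at `2q` however long
      -- the chain is.
      _ = b ^ (I.card + 1) + (q + (2 * b) * q) := by ring
      _ ≤ b ^ (I.card + 1) + (q + 1 * q) := by gcongr
      _ = b ^ (insert i₀ I).card + 2 * q := by
          rw [Finset.card_insert_of_notMem hi₀]; ring

/-! ### Greedy choice of the families -/

lemma card_le_of_card_line_le (k : Fin ℓ) (K : Finset (Fin ℓ → Fin n)) (c : ℕ)
    (h : ∀ t : Fin ℓ → Fin n,
      (Finset.univ.filter fun a => Function.update t k a ∈ K).card ≤ c) :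
    K.card ≤ c * n ^ (ℓ - 1) := by
  classical
  have hcard : (Finset.univ : Finset ({j : Fin ℓ // j ≠ k} → Fin n)).card = n ^ (ℓ - 1) := by
    rw [Finset.card_univ, Fintype.card_fun, Fintype.card_fin, Fintype.card_subtype_compl]
    simp
  rw [← hcard]
  refine Finset.card_le_mul_card_image_of_maps_to
    (f := fun t (j : {j : Fin ℓ // j ≠ k}) => t j) (fun _ _ => Finset.mem_univ _) c ?_
  intro g _
  rcases Finset.eq_empty_or_nonempty (K.filter fun t => (fun j : {j : Fin ℓ // j ≠ k} => t j) = g)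
    with h0 | ⟨t, ht⟩
  · rw [h0]; simp
  · have hup : ∀ s ∈ K.filter (fun t => (fun j : {j : Fin ℓ // j ≠ k} => t j) = g),
        Function.update t k (s k) = s := by
      intro s hs
      funext j
      rcases eq_or_ne j k with rfl | hj
      · simp
      · rw [Function.update_of_ne hj]
        exact congrFun ((Finset.mem_filter.1 ht).2.trans (Finset.mem_filter.1 hs).2.symm) ⟨j, hj⟩
    refine (Finset.card_le_card_of_injOn (fun s => s k) ?_ ?_).trans (h t)
    · intro s hs
      have hs' : s ∈ K := (Finset.mem_filter.1 hs).1
      simpa [hup s hs] using hs'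
    · intro s hs s' hs' hss
      rw [← hup s hs, ← hup s' hs']
      exact congrArg _ hss

/-- Each prescribed zero is one linear condition, so it costs at most one dimension. -/
lemma exists_submodule_forall_eq_zero {ι : Type*} [Fintype ι]
    (V : Submodule ℝ (EuclideanSpace ℝ ι)) (K : Finset ι) :
    ∃ V' ≤ V, Module.finrank ℝ V ≤ Module.finrank ℝ V' + K.card ∧
      ∀ w ∈ V', ∀ s ∈ K, w s = 0 := by
  let L : V →ₗ[ℝ] (K → ℝ) :=
    { toFun := fun w s => (w : EuclideanSpace ℝ ι) s
      map_add' := fun _ _ => rfl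
      map_smul' := fun _ _ => rfl }
  refine ⟨(LinearMap.ker L).map V.subtype, Submodule.map_subtype_le _ _, ?_, ?_⟩
  · rw [Submodule.finrank_map_subtype_eq, ← LinearMap.finrank_range_add_finrank_ker L, add_comm]
    gcongr
    exact (Submodule.finrank_le _).trans (by simp)
  · rintro _ ⟨w, hw, rfl⟩ s hs
    exact congrFun (LinearMap.mem_ker.1 hw) ⟨s, hs⟩

/-- A nonzero subspace contains a vector whose largest entry in absolute value is `1`. -/
lemma exists_mem_entry_eq_one {ι : Type*} [Fintype ι] (V : Submodule ℝ (EuclideanSpace ℝ ι))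
    (hV : 0 < Module.finrank ℝ V) :
    ∃ w ∈ V, ∃ p, w p = 1 ∧ ∀ t, |w t| ≤ 1 := by
  obtain ⟨w, hw, hw0⟩ := (Submodule.ne_bot_iff V).1 (Submodule.one_le_finrank_iff.1 hV)
  obtain ⟨t, ht⟩ : ∃ t, w t ≠ 0 := by
    by_contra! h
    exact hw0 (by ext t; simpa using h t)
  have : Nonempty ι := ⟨t⟩
  obtain ⟨p, hp⟩ := Finite.exists_max fun t => |w t|
  have hwp : 0 < |w p| := (abs_pos.2 ht).trans_le (hp t)
  refine ⟨(w p)⁻¹ • w, V.smul_mem _ hw, p, ?_, fun t => ?_⟩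
  · simp [inv_mul_cancel₀ (abs_pos.1 hwp)]
  · simp only [PiLp.smul_apply, smul_eq_mul, abs_mul, abs_inv]
    rw [inv_mul_le_iff₀ hwp, mul_one]
    exact hp t

/-- A subspace of dimension more than `k (m - 1) n ^ (ℓ - 1)` contains finitely many tensors with
entries at most `1`, one of which has a large contraction of the first `k` modes at a fixed
position, with failure probability at most `(2 ^ k - 1) b ^ m`. -/
lemma exists_measure_smallContractionSet_le (μ : Fin ℓ × Fin n → Measure ℝ)
    [∀ i, IsProbabilityMeasure (μ i)] {η : ℝ} (hη : 0 < η) {b : ℝ≥0∞} (hb : 2 * b ≤ 1)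
    (hμ : ∀ i c, μ i {t | |t + c| < η} ≤ b) {m : ℕ} (hm : 1 ≤ m) (hbm : 2 ^ ℓ * b ^ m < 1)
    (k : ℕ) (hk : k ≤ ℓ) (V : Submodule ℝ (TensorSpace n ℓ))
    (hV : k * ((m - 1) * n ^ (ℓ - 1)) < Module.finrank ℝ V) :
    ∃ (p : Fin ℓ → Fin n) (F : Finset (TensorSpace n ℓ)),
      (∀ w ∈ F, w ∈ V ∧ ∀ t, |w t| ≤ 1) ∧
      Measure.pi μ (smallContractionSet η k F p) ≤ ((2 ^ k - 1 : ℕ) : ℝ≥0∞) * b ^ m := by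
  classical
  induction k generalizing V with
  | zero =>
    obtain ⟨w, hw, p, hp, hw1⟩ := exists_mem_entry_eq_one V (by simpa using hV)
    refine ⟨p, {w}, by simpa using ⟨hw, hw1⟩, ?_⟩
    have : smallContractionSet η 0 {w} p = ∅ := by
      ext y
      simp [smallContractionSet, partialContraction_zero, hp]
    simp [this]
  | succ k ih =>
    specialize ih (by omega)
    by_contra hno
    set q : ℝ≥0∞ := ((2 ^ k - 1 : ℕ) : ℝ≥0∞) * b ^ m with hq
    have hq1 : q < 1 := by
      refine lt_of_le_of_lt ?_ hbm
      rw [hq]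
      gcongr
      have : 2 ^ k - 1 ≤ 2 ^ ℓ := (Nat.sub_le _ _).trans (Nat.pow_le_pow_right (by norm_num) (by omega))
      exact_mod_cast this
    have hb1 : b ≤ 1 := le_trans (by rw [two_mul]; exact le_self_add) hb
    -- If the conclusion fails, the greedy construction never stops; this will contradict the
    -- finiteness of the set of positions.
    have hchain : ∀ N : ℕ, ∃ (p : ℕ → Fin ℓ → Fin n) (F : ℕ → Finset (TensorSpace n ℓ)),
        ∀ i < N, (∀ w ∈ F i, w ∈ V ∧ ∀ t, |w t| ≤ 1) ∧
          Measure.pi μ (smallContractionSet η k (F i) (p i)) ≤ q ∧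
          ∀ i' < i, ∀ w ∈ F i, ∀ s : Fin ℓ → Fin n,
            (∀ j : Fin ℓ, k ≤ j → s j = p i' j) → w s = 0 := by
      intro N
      induction N with
      | zero =>
        obtain ⟨p, -⟩ := ih V (lt_of_le_of_lt (by gcongr; omega) hV)
        exact ⟨fun _ => p, fun _ => ∅, by simp⟩
      | succ N ihN =>
        obtain ⟨p, F, hpF⟩ := ihN
        let K : Finset (Fin ℓ → Fin n) :=
          Finset.univ.filter fun s => ∃ i < N, ∀ j : Fin ℓ, k ≤ j → s j = p i j
        have hK : K.card ≤ (m - 1) * n ^ (ℓ - 1) := by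
          refine card_le_of_card_line_le ⟨k, hk⟩ K _ fun t => ?_
          -- A line in mode `k` meeting `K` in `m` points yields `m` earlier families to combine,
          -- contradicting `hno`.
          by_contra! hlt
          let I := (Finset.range N).filter fun i => ∀ j : Fin ℓ, k < j → p i j = t j
          have hI : m ≤ I.card := by
            refine le_trans (by omega : m ≤ (Finset.univ.filter
              fun a => Function.update t ⟨k, hk⟩ a ∈ K).card) ?_
            refine (Finset.card_le_card ?_).trans
              (Finset.card_image_le (s := I) (f := fun i => p i ⟨k, hk⟩))
            intro a ha
            obtain ⟨i, hi, hij⟩ := (Finset.mem_filter.1 (Finset.mem_filter.1 ha).2).2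
            refine Finset.mem_image.2 ⟨i, Finset.mem_filter.2 ⟨Finset.mem_range.2 hi, ?_⟩, ?_⟩
            · intro j hj
              rw [← hij j hj.le, Function.update_of_ne]
              rintro rfl
              simp at hj
            · simpa using (hij ⟨k, hk⟩ le_rfl).symm
          have hIN : ∀ i ∈ I, i < N := fun i hi => Finset.mem_range.1 (Finset.mem_filter.1 hi).1
          refine hno ⟨t, I.biUnion F, ?_, ?_⟩
          · intro w hw
            obtain ⟨i, hi, hwi⟩ := Finset.mem_biUnion.1 hw
            exact (hpF i (hIN i hi)).1 w hwi
          · have hset : smallContractionSet η (k + 1) (I.biUnion F) t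
                = ⋂ i ∈ I, smallContractionSet η (k + 1) (F i) t := by
              ext y
              simp only [smallContractionSet, Finset.mem_biUnion, Set.mem_ofPred_eq, Set.mem_iInter]
              exact ⟨fun h i hi w hw => h w ⟨i, hi, hw⟩, fun h w ⟨i, hi, hw⟩ => h i hi w hw⟩
            rw [hset]
            refine (measure_iInter_smallContractionSet_succ_le μ hη hb hμ hk t p F I
              (fun i hi => (Finset.mem_filter.1 hi).2)
              (fun i hi i' _ hlt => (hpF i (hIN i hi)).2.2 i' hlt)
              (fun i hi => (hpF i (hIN i hi)).2.1)).trans ?_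
            have hpow : 2 ^ (k + 1) - 1 = 1 + 2 * (2 ^ k - 1) := by
              have := Nat.one_le_two_pow (n := k)
              rw [pow_succ]; omega
            calc b ^ I.card + 2 * q ≤ b ^ m + 2 * q := by
                  gcongr ?_ + _
                  exact pow_le_pow_right_of_le_one' hb1 hI
              _ = ((2 ^ (k + 1) - 1 : ℕ) : ℝ≥0∞) * b ^ m := by
                  rw [hpow, hq, Nat.cast_add, Nat.cast_mul, Nat.cast_one, Nat.cast_two]; ring
        obtain ⟨V', hV'V, hV'dim, hV'0⟩ : ∃ V' : Submodule ℝ (TensorSpace n ℓ), V' ≤ V ∧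
            Module.finrank ℝ V ≤ Module.finrank ℝ V' + K.card ∧ ∀ w ∈ V', ∀ s ∈ K, w s = 0 :=
          exists_submodule_forall_eq_zero V K
        obtain ⟨p', F', hF', hq'⟩ := ih V' (by
          have : (k + 1) * ((m - 1) * n ^ (ℓ - 1))
            = k * ((m - 1) * n ^ (ℓ - 1)) + (m - 1) * n ^ (ℓ - 1) := by ring
          omega)
        refine ⟨Function.update p N p', Function.update F N F', fun i hi => ?_⟩
        rcases Nat.lt_succ_iff_lt_or_eq.1 hi with hiN | rfl
        · rw [Function.update_of_ne hiN.ne, Function.update_of_ne hiN.ne]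
          refine ⟨(hpF i hiN).1, (hpF i hiN).2.1, fun i' hi' => ?_⟩
          rw [Function.update_of_ne (hi'.trans hiN).ne]
          exact (hpF i hiN).2.2 i' hi'
        · rw [Function.update_self, Function.update_self]
          refine ⟨fun w hw => ⟨hV'V (hF' w hw).1, (hF' w hw).2⟩, hq', fun i' hi' w hw s hs => ?_⟩
          rw [Function.update_of_ne hi'.ne] at hs
          exact hV'0 w (hF' w hw).1 s (Finset.mem_filter.2 ⟨Finset.mem_univ _, i', hi', hs⟩)
    obtain ⟨p, F, hpF⟩ := hchain (Fintype.card (Fin ℓ → Fin n) + 1)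
    -- A repeated position would make every contraction in the later family zero, so its failure
    -- probability would be `1 > q`.
    have hne : ∀ i < Fintype.card (Fin ℓ → Fin n) + 1, ∀ i' < i, p i' ≠ p i := by
      intro i hi i' hi' heq
      obtain ⟨-, hqi, hzero⟩ := hpF i hi
      have huniv : smallContractionSet η k (F i) (p i) = Set.univ := by
        refine Set.eq_univ_of_forall fun y w hw => ?_
        rw [partialContraction_eq_zero (heq ▸ hzero i' hi' w hw), abs_zero]
        positivity
      rw [huniv, measure_univ] at hqi
      exact absurd hqi (not_le.2 hq1)
    have hcard := Finset.card_le_card_of_injOn (s := Finset.range (Fintype.card (Fin ℓ → Fin n) + 1))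
      (t := Finset.univ) p (fun _ _ => Finset.mem_univ _) (by
        intro i hi i' hi' heq
        simp only [Finset.coe_range, Set.mem_Iio] at hi hi'
        rcases lt_trichotomy i i' with h | h | h
        · exact absurd heq (hne i' hi' i h)
        · exact h
        · exact absurd heq.symm (hne i hi i' h))
    rw [Finset.card_range, Finset.card_univ] at hcard
    omega

end SmallContraction

/-! ### From contractions to the projection -/

/-- A tensor with entries at most `1` in absolute value has norm at most `√n ^ ℓ`. -/
lemma norm_le_of_forall_abs_le_one {n ℓ : ℕ} {w : TensorSpace n ℓ} (hw : ∀ t, |w t| ≤ 1) :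
    ‖w‖ ≤ √(n : ℝ) ^ ℓ := by
  rw [EuclideanSpace.norm_eq]
  refine (Real.sqrt_le_left (by positivity)).2 ?_
  calc ∑ t, ‖w t‖ ^ 2 ≤ ∑ _t : Fin ℓ → Fin n, (1 : ℝ) :=
        Finset.sum_le_sum fun t _ => pow_le_one₀ (norm_nonneg _) (hw t)
    _ = (√(n : ℝ) ^ ℓ) ^ 2 := by
        rw [← pow_mul, mul_comm, pow_mul, Real.sq_sqrt (Nat.cast_nonneg n)]
        simp

lemma partialContraction_self_eq_inner {n ℓ : ℕ} (w : TensorSpace n ℓ) (p : Fin ℓ → Fin n)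
    (v : Fin ℓ → EuclideanSpace ℝ (Fin n)) :
    partialContraction ℓ w p (fun q => v q.1 q.2) = inner ℝ w (rankOneTensor v) := by
  rw [partialContraction_self, PiLp.inner_apply]
  simp [rankOneTensor, mul_comm]

/-- If the projection of a vector to `W` is short, so are its inner products with `W`. -/
lemma abs_inner_le_norm_mul_norm_starProjection {E : Type*} [NormedAddCommGroup E]
    [InnerProductSpace ℝ E] (W : Submodule ℝ E) [W.HasOrthogonalProjection] {w : E} (hw : w ∈ W)
    (r : E) : |inner ℝ w r| ≤ ‖w‖ * ‖W.starProjection r‖ := by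
  have h : inner ℝ w r = inner ℝ w (W.starProjection r) := by
    rw [← W.inner_starProjection_left_eq_right, W.starProjection_eq_self_iff.2 hw]
  rw [h]
  exact abs_real_inner_le_norm _ _

/-- The coordinates of the perturbed vectors are independent Gaussians. -/
lemma IsPerturbationNoise.hasLaw_add {Ω : Type*} [MeasurableSpace Ω] {P : Measure Ω} {n ℓ : ℕ}
    {ρ : ℝ} {z : Fin ℓ → Ω → EuclideanSpace ℝ (Fin n)} (hz : IsPerturbationNoise P ρ z)
    (x : Fin ℓ → EuclideanSpace ℝ (Fin n)) :
    HasLaw (fun ω (q : Fin ℓ × Fin n) => (x q.1 + z q.1 ω) q.2)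
      (Measure.pi fun q => gaussianReal (x q.1 q.2) (ρ ^ 2 / n).toNNReal) P := by
  have hlaw : ∀ q : Fin ℓ × Fin n, HasLaw (fun ω => x q.1 q.2 + z q.1 ω q.2)
      (gaussianReal (x q.1 q.2) (ρ ^ 2 / n).toNNReal) P := by
    intro q
    simpa using gaussianReal_const_add (hz.hasLaw q.1 q.2) (x q.1 q.2)
  have hind : iIndepFun (fun (q : Fin ℓ × Fin n) ω => x q.1 q.2 + z q.1 ω q.2) P :=
    hz.indep.comp (fun q a => x q.1 q.2 + a) fun q => by fun_prop
  exact hind.hasLaw_pi hlaw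

theorem lemma4p6 (ℓ : ℕ) (hℓ : 1 ≤ ℓ) :
    ∃ c₁ c₂ : ℝ, 0 < c₁ ∧ 0 < c₂ ∧
      ∀ (n : ℕ), 1 ≤ n →
      ∀ (δ : ℝ), 0 < δ → δ < 1 / (ℓ : ℝ) →
      ∀ (ρ : ℝ), 0 < ρ →
      ∀ (W : Submodule ℝ (TensorSpace n ℓ)), δ * (n : ℝ) ^ ℓ ≤ (Module.finrank ℝ W : ℝ) →
      ∀ (x : Fin ℓ → EuclideanSpace ℝ (Fin n)),
      ∀ (Ω : Type*) [MeasurableSpace Ω] (P : Measure Ω) [IsProbabilityMeasure P]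
        (z : Fin ℓ → Ω → EuclideanSpace ℝ (Fin n)), IsPerturbationNoise P ρ z →
        P.real {ω | ‖W.starProjection (rankOneTensor fun j => x j + z j ω)‖
              < c₁ * ρ ^ ℓ / (n : ℝ) ^ ℓ}
          ≤ Real.exp (-c₂ * δ * n) := by
  -- The factor `2 ^ ℓ` absorbs the loss `2 ^ ℓ - 1` from the induction, leaving `exp (-m)`.
  set b : ℝ := Real.exp (-1) / 2 ^ ℓ with hb
  have hb0 : 0 < b := by positivity
  have hb2 : 2 * b ≤ 1 := by
    have h1 : Real.exp (-1) ≤ 1 := Real.exp_le_one_iff.2 (by norm_num)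
    have h2 : (2 : ℝ) ^ 1 ≤ 2 ^ ℓ := pow_le_pow_right₀ (by norm_num) hℓ
    rw [hb, mul_div_assoc', div_le_one (by positivity)]
    linarith
  have hℓ0 : (0 : ℝ) < ℓ := by exact_mod_cast hℓ
  refine ⟨b ^ ℓ, 1 / ℓ, by positivity, by positivity, ?_⟩
  intro n hn δ hδ _ ρ hρ W hW x Ω _ P _ z hz
  have hn0 : (0 : ℝ) < n := by exact_mod_cast hn
  -- Rounding up gives `m - 1 < δn/ℓ`, which the dimension count needs, and `m ≥ δn/ℓ`, which the
  -- final exponent needs.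
  set m := ⌈δ * n / ℓ⌉₊ with hm
  have hδn : 0 < δ * n / ℓ := by positivity
  have hm1 : 1 ≤ m := Nat.ceil_pos.2 hδn
  have hbm : 2 ^ ℓ * b ^ m ≤ Real.exp (-m) := by
    calc 2 ^ ℓ * b ^ m ≤ (2 ^ ℓ) ^ m * b ^ m := by
          gcongr
          exact le_self_pow₀ (one_le_pow₀ (by norm_num)) (by omega)
      _ = Real.exp (-m) := by
          rw [← mul_pow, hb, mul_div_cancel₀ _ (by positivity), ← Real.exp_nat_mul]
          simp
  have hbm' : (2 : ℝ≥0∞) ^ ℓ * ENNReal.ofReal b ^ m ≤ ENNReal.ofReal (Real.exp (-m)) := by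
    refine le_of_eq_of_le ?_ (ENNReal.ofReal_le_ofReal hbm)
    rw [ENNReal.ofReal_mul (by positivity), ENNReal.ofReal_pow hb0.le,
      ENNReal.ofReal_pow (by norm_num), ENNReal.ofReal_ofNat]
  set v : NNReal := (ρ ^ 2 / n).toNNReal with hv
  have hvpos : 0 < v := Real.toNNReal_pos.2 (by positivity)
  have hsv : √(v : ℝ) = ρ / √n := by
    rw [hv, Real.coe_toNNReal _ (by positivity), Real.sqrt_div (by positivity), Real.sqrt_sq hρ.le]
  -- This is `b` standard deviations, so the small-ball probability is at most `b`.
  set η : ℝ := b * ρ / √n with hη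
  have hη0 : 0 < η := by positivity
  have hdim : ℓ * ((m - 1) * n ^ (ℓ - 1)) < Module.finrank ℝ W := by
    have h1 : ((m - 1 : ℕ) : ℝ) < δ * n / ℓ := by
      rw [Nat.cast_sub hm1, Nat.cast_one, sub_lt_iff_lt_add]
      exact Nat.ceil_lt_add_one hδn.le
    have h2 : (ℓ : ℝ) * (((m - 1 : ℕ) : ℝ) * n ^ (ℓ - 1)) < Module.finrank ℝ W := by
      calc (ℓ : ℝ) * (((m - 1 : ℕ) : ℝ) * n ^ (ℓ - 1))
          < ℓ * (δ * n / ℓ * n ^ (ℓ - 1)) := by gcongr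
        _ = δ * (n ^ (ℓ - 1) * n) := by field_simp
        _ = δ * n ^ ℓ := by rw [← pow_succ, Nat.sub_add_cancel hℓ]
        _ ≤ _ := hW
    exact_mod_cast h2
  obtain ⟨p, F, hF, hFμ⟩ := exists_measure_smallContractionSet_le
    (fun q : Fin ℓ × Fin n => gaussianReal (x q.1 q.2) v) hη0 (b := ENNReal.ofReal b)
    (by rw [← ENNReal.ofReal_ofNat, ← ENNReal.ofReal_mul (by norm_num)]
        exact ENNReal.ofReal_le_one.2 hb2)
    (fun q c => (gaussianReal_abs_add_lt_le _ hvpos.ne' c η).trans_eq (by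
      rw [hsv, hη]; congr 1; field_simp))
    hm1 (hbm'.trans_lt (by
      rw [ENNReal.ofReal_lt_one, Real.exp_lt_one_iff, neg_lt_zero]
      exact_mod_cast hm1)) ℓ le_rfl W hdim
  have hlaw := hz.hasLaw_add x
  have hsub : {ω | ‖W.starProjection (rankOneTensor fun j => x j + z j ω)‖
        < b ^ ℓ * ρ ^ ℓ / (n : ℝ) ^ ℓ}
      ⊆ (fun ω (q : Fin ℓ × Fin n) => (x q.1 + z q.1 ω) q.2) ⁻¹' smallContractionSet η ℓ F p := by
    intro ω hω w hw
    rw [partialContraction_self_eq_inner w p fun j => x j + z j ω]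
    calc _ ≤ ‖w‖ * ‖W.starProjection (rankOneTensor fun j => x j + z j ω)‖ :=
          abs_inner_le_norm_mul_norm_starProjection W (hF w hw).1 _
      _ ≤ √(n : ℝ) ^ ℓ * ‖W.starProjection (rankOneTensor fun j => x j + z j ω)‖ := by
          gcongr
          exact norm_le_of_forall_abs_le_one (hF w hw).2
      _ < √(n : ℝ) ^ ℓ * (b ^ ℓ * ρ ^ ℓ / (n : ℝ) ^ ℓ) := by
          gcongr
          exact hω
      _ = η ^ ℓ := by
          rw [hη, ← mul_pow, ← div_pow, ← mul_pow]
          congr 1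
          nth_rewrite 2 [← Real.mul_self_sqrt hn0.le]
          field_simp
  have hP : P {ω | ‖W.starProjection (rankOneTensor fun j => x j + z j ω)‖
        < b ^ ℓ * ρ ^ ℓ / (n : ℝ) ^ ℓ} ≤ ENNReal.ofReal (Real.exp (-m)) := by
    calc _ ≤ P _ := measure_mono hsub
      _ = Measure.pi _ (smallContractionSet η ℓ F p) := by
          rw [← hlaw.map_eq, Measure.map_apply_of_aemeasurable hlaw.aemeasurable
            (measurableSet_smallContractionSet _ _ _ _)]
      _ ≤ ((2 ^ ℓ - 1 : ℕ) : ℝ≥0∞) * ENNReal.ofReal b ^ m := hFμ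
      _ ≤ 2 ^ ℓ * ENNReal.ofReal b ^ m := by
          gcongr
          exact_mod_cast Nat.sub_le _ _
      _ ≤ _ := hbm'
  calc P.real _ ≤ Real.exp (-m) := ENNReal.toReal_le_of_le_ofReal (Real.exp_nonneg _) hP
    _ ≤ Real.exp (-(1 / ℓ) * δ * n) := by
        refine Real.exp_le_exp.2 ?_
        have := Nat.le_ceil (δ * n / ℓ)
        rw [← hm] at this
        calc -(m : ℝ) ≤ -(δ * n / ℓ) := neg_le_neg this
          _ = -(1 / ℓ) * δ * n := by ring
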